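/- Let $X$ be a path-connected, locally path-connected topological space, let $x_0\in X$, and let $\pi_1(X,x_0)$ carry the quotient topology of the loop space $\Omega(X,x_0)$ with the compact-open topology. Then a subgroup $H\le\pi_1(X,x_0)$ is an intersection of open normal subgroups of $\pi_1(X,x_0)$ if and only if there is an inverse limit $p:(E,e_0)\to(X,x_0)$ of regular covering projections that corresponds to $H$. Here a regular covering projection is a covering map $q:E'\to X$ with $E'$ non-empty and path connected such that $q_\#(\pi_1(E',e'))$ is normal in $\pi_1(X,q(e'))$ for every $e'\in E'$. An inverse limit of regular covering projections is a map $p:E\to X$ obtained as follows: $J$ is a non-empty directed set, $p_j:E_j\to X$ ($j\in J$) are regular covering projections, $f_{j,j'}:E_j\to E_{j'}$ ($j\ge j'$) are continuous maps forming an inverse system with $p_{j'}\circ f_{j,j'}=p_j$, $E$ is the path component of a point $e_0$ of $\varprojlim_j(E_j,f_{j,j'})$ with the subspace topology, and $p$ is the restriction to $E$ of the map $\varprojlim_j E_j\to X$ induced by the $p_j$. A based map $p:(E,e_0)\to(X,x_0)$ corresponds to $H$ if it has the continuous path-covering property and $p_\#(\pi_1(E,e_0))=H$; the continuous path-covering property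 means that, for every $e\in E$, the map $\gamma\mapsto p\circ\gamma$ from the space of paths in $E$ starting at $e$ to the space of paths in $X$ starting at $p(e)$ (compact-open topologies) is a homeomorphism. -/

import Mathlib

open Topology

/-! ### The fundamental group with the quotient topology -/

/-- The quotient topology on `π₁(X, x₀)`: the finest topology making `γ ↦ [γ]` continuous on the
loop space `Ω(X, x₀) = Path x₀ x₀`, which carries the compact-open topology. -/
@[reducible]
def piOneTopology {X : Type*} [TopologicalSpace X] (x₀ : X) :
    TopologicalSpace (FundamentalGroup X x₀) :=
  TopologicalSpace.coinduced
    (fun γ : Path x₀ x₀ => FundamentalGroup.fromPath (Path.Homotopic.Quotient.mk γ)) inferInstance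

/-- A subgroup of `π₁(X, x₀)` that is normal and open in the quotient topology. -/
def IsOpenNormal {X : Type*} [TopologicalSpace X] {x₀ : X}
    (N : Subgroup (FundamentalGroup X x₀)) : Prop :=
  N.Normal ∧ IsOpen[piOneTopology x₀] (N : Set (FundamentalGroup X x₀))

/-- `H` is the intersection of a family of open normal subgroups of `π₁(X, x₀)`. -/
def IsInterOpenNormal {X : Type*} [TopologicalSpace X] {x₀ : X}
    (H : Subgroup (FundamentalGroup X x₀)) : Prop :=
  ∃ 𝒩 : Set (Subgroup (FundamentalGroup X x₀)), (∀ N ∈ 𝒩, IsOpenNormal N) ∧ H = sInf 𝒩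

/-- The subgroup `p_#(π₁(E, e₀))` of `π₁(X, x₀)`, where `p e₀ = x₀`. -/
noncomputable def imagePiOne {E X : Type*} [TopologicalSpace E] [TopologicalSpace X]
    (p : C(E, X)) {e₀ : E} {x₀ : X} (h : p e₀ = x₀) : Subgroup (FundamentalGroup X x₀) :=
  (FundamentalGroup.mapOfEq p h).range

/-! ### Based path spaces and the continuous path-covering property -/

/-- The space `P(X, x)` of paths in `X` starting at `x`, with the compact-open topology. -/
abbrev BasedPaths (X : Type*) [TopologicalSpace X] (x : X) : Type _ :=
  {γ : C(unitInterval, X) // γ 0 = x}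

/-- The induced map `P(p) : P(E, e) → P(X, p e)`, `γ ↦ p ∘ γ`. -/
def BasedPaths.map {E X : Type*} [TopologicalSpace E] [TopologicalSpace X] (p : C(E, X)) (e : E) :
    BasedPaths E e → BasedPaths X (p e) :=
  fun γ => ⟨p.comp γ.1, congrArg p γ.2⟩

/-- The continuous path-covering property: `P(p) : P(E, e) → P(X, p e)` is a homeomorphism for
every `e`. -/
def HasContinuousPathCovering {E X : Type*} [TopologicalSpace E] [TopologicalSpace X]
    (p : C(E, X)) : Prop :=
  ∀ e : E, IsHomeomorph (BasedPaths.map p e)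

/-- A based map `p : (E, e₀) → (X, x₀)` *corresponds* to `H ≤ π₁(X, x₀)` if it has the continuous
path-covering property and `p_#(π₁(E, e₀)) = H`. -/
def Corresponds {E X : Type*} [TopologicalSpace E] [TopologicalSpace X] (p : C(E, X))
    {e₀ : E} {x₀ : X} (h : p e₀ = x₀) (H : Subgroup (FundamentalGroup X x₀)) : Prop :=
  HasContinuousPathCovering p ∧ imagePiOne p h = H

/-- A regular covering projection: a covering map with non-empty path-connected total space `E`
such that `p_#(π₁(E, e))` is normal in `π₁(X, p e)` for every `e`. -/
structure IsRegularCoveringProjection {E X : Type*} [TopologicalSpace E] [TopologicalSpace X]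
    (p : C(E, X)) : Prop where
  pathConnected : PathConnectedSpace E
  isCoveringMap : IsCoveringMap p
  normal : ∀ e : E, (imagePiOne p (rfl : p e = p e)).Normal

/-! ### Inverse systems of spaces over `X` and their limits -/

universe u

/-- An inverse system of spaces `p j : E j → X` over `X`, indexed by a (non-empty) directed set
`J`, with continuous bonding maps `f h : E j → E i` over `X` for `i ≤ j`. -/
structure InverseSystemOver (X : Type u) [TopologicalSpace X] where
  /-- the index set -/
  J : Type u
  [preorder : Preorder J]
  [directed : IsDirectedOrder J]
  [nonempty : Nonempty J]
  /-- the total spaces -/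
  E : J → Type u
  [topology : ∀ j, TopologicalSpace (E j)]
  /-- the maps to `X` -/
  p : ∀ j, C(E j, X)
  /-- the bonding maps -/
  f : ∀ {i j : J}, i ≤ j → C(E j, E i)
  f_refl : ∀ (j : J) (x : E j), f (le_refl j) x = x
  f_comp : ∀ {i j k : J} (hij : i ≤ j) (hjk : j ≤ k) (x : E k),
    f hij (f hjk x) = f (hij.trans hjk) x
  p_comp : ∀ {i j : J} (h : i ≤ j) (x : E j), p i (f h x) = p j x

namespace InverseSystemOver

attribute [instance] preorder directed nonempty topology

variable {X : Type u} [TopologicalSpace X] (S : InverseSystemOver X)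

/-- The inverse limit: the compatible families in the product, with the subspace topology of the
product topology. -/
abbrev Limit : Type u :=
  {x : ∀ j, S.E j // ∀ (i j : S.J) (h : i ≤ j), S.f h (x j) = x i}

/-- The map from the inverse limit to `X` induced by the maps `p j`. By `limitMap_apply` it is
`x ↦ p j (x j)` for each index `j`. -/
noncomputable def limitMap : C(S.Limit, X) where
  toFun x := S.p (Classical.arbitrary S.J) (x.1 (Classical.arbitrary S.J))
  continuous_toFun := (S.p _).continuous.comp ((continuous_apply _).comp continuous_subtype_val)

theorem limitMap_apply (x : S.Limit) (j : S.J) : S.limitMap x = S.p j (x.1 j) := by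
  obtain ⟨k, h₀, hj⟩ := exists_ge_ge (Classical.arbitrary S.J) j
  change S.p (Classical.arbitrary S.J) (x.1 (Classical.arbitrary S.J)) = _
  rw [← x.2 _ k h₀, ← x.2 _ k hj, S.p_comp, S.p_comp]

/-- The path component of a point of the inverse limit, with the subspace topology. -/
abbrev Component (e : S.Limit) : Type u := pathComponent e

/-- The point `e`, viewed as a point of its path component. -/
def basePoint (e : S.Limit) : S.Component e := ⟨e, mem_pathComponent_self e⟩

/-- The restriction to the path component of `e` of the map from the inverse limit to `X`. -/
noncomputable def componentMap (e : S.Limit) : C(S.Component e, X) where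
  toFun x := S.limitMap x.1
  continuous_toFun := S.limitMap.continuous.comp continuous_subtype_val

end InverseSystemOver

/-!
A covering `q : (E', e') → (X, x₀)` recovers `q_#(π₁(E', e'))` as the set of classes of loops whose
lifts close up. Since lifts depend continuously on the path and fibres are discrete, this subgroup
is open in the quotient topology (`IsCoveringMap.isOpen_imagePiOne`). In an inverse limit of
coverings, a path lifts by lifting it to every covering; uniqueness makes the lifts compatible
(`InverseSystemOver.liftComponent`), and continuity is checked in each coordinate. Hence the limit
has the continuous path-covering property, and its subgroup is the intersection of the subgroups of
the coverings (`InverseSystemOver.imagePiOne_componentMap`). A subgroup corresponding to a limit of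
regular coverings is therefore an intersection of open normal subgroups.

Conversely, it remains to realise each open normal subgroup `N` by a regular covering, functorially
in `N`. Fixing paths from `x₀` to all points turns every path in `X` into a loop at `x₀`, and so
gives a holonomy with values in `π₁(X, x₀) / N` (`Holonomy.ofNormal`). If `N` is open, then
loops inside a small neighbourhood of a point have trivial holonomy
(`Holonomy.ofNormal_isLocallyTrivial`). Then `X × (π₁(X, x₀) / N)`, with the topology in which
points are close if they differ by transport along a small path, is a covering space of `X`
(`Holonomy.IsLocallyTrivial.isCoveringMap_proj`), and a loop lifts to a loop in it exactly if its
holonomy is trivial. The quotient maps `π₁(X, x₀) / N → π₁(X, x₀) / M` for `N ≤ M` induce the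
bonding maps.
-/

/-! ### Small loops in the compact-open topology -/

open Set Filter unitInterval in
/-- Loops at `x` with small range are close to the constant loop: every neighbourhood of the
constant loop in the compact-open topology contains all the loops with range in some
neighbourhood of `x`. -/
theorem exists_isOpen_forall_loop_mem {X : Type*} [TopologicalSpace X] {x : X}
    {O : Set (Path x x)} (hO : O ∈ 𝓝 (Path.refl x)) :
    ∃ W : Set X, IsOpen W ∧ x ∈ W ∧ ∀ β : Path x x, (∀ t, β t ∈ W) → β ∈ O := by
  have key : Tendsto (id : Path x x → Path x x)
      ((𝓝 x).smallSets.comap fun β : Path x x => range β) (𝓝 (Path.refl x)) := by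
    rw [nhds_induced, tendsto_comap_iff, ContinuousMap.tendsto_nhds_compactOpen]
    intro K _ U hU hKU
    rcases K.eq_empty_or_nonempty with rfl | ⟨t, ht⟩
    · exact Eventually.of_forall fun _ _ h => h.elim
    · have hx : U ∈ 𝓝 x := hU.mem_nhds (hKU ht)
      refine (tendsto_comap.eventually (eventually_smallSets_subset.mpr hx)).mono fun β hβ s _ => ?_
      exact hβ ⟨s, rfl⟩
  have h := key hO
  rw [Filter.mem_map, preimage_id, mem_comap] at h
  obtain ⟨T, hT, hTO⟩ := h
  obtain ⟨W, hW, hWT⟩ := eventually_smallSets.mp hT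
  obtain ⟨V, hVW, hV, hxV⟩ := mem_nhds_iff.mp hW
  exact ⟨V, hV, hxV, fun β hβ => hTO (hWT _ (range_subset_iff.mpr fun t => hVW (hβ t)))⟩

/-! ### Holonomies and their covering spaces -/

/-- A holonomy on `X` with values in a group `G`: an assignment of elements of `G` to homotopy
classes of paths that turns concatenation into multiplication. As in `FundamentalGroup`, the path
travelled first is the right factor, so a holonomy is a functor from the fundamental groupoid to
`G`. -/
structure Holonomy (X : Type*) [TopologicalSpace X] (G : Type*) [Group G] where
  /-- the value on a class of paths -/
  hol : ∀ {x y : X}, Path.Homotopic.Quotient x y → G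
  hol_trans : ∀ {x y z : X} (γ : Path.Homotopic.Quotient x y) (δ : Path.Homotopic.Quotient y z),
    hol (γ.trans δ) = hol δ * hol γ

namespace Holonomy

variable {X : Type*} [TopologicalSpace X] {G : Type*} [Group G] (Φ : Holonomy X G)

theorem hol_refl (x : X) : Φ.hol (.refl x) = 1 := by
  have h := Φ.hol_trans (.refl x) (.refl x)
  rw [Path.Homotopic.Quotient.refl_trans] at h
  exact left_eq_mul.mp h

theorem hol_mk_trans {x y z : X} (γ : Path x y) (δ : Path y z) :
    Φ.hol (.mk (γ.trans δ)) = Φ.hol (.mk δ) * Φ.hol (.mk γ) := by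
  rw [Path.Homotopic.Quotient.mk_trans, Φ.hol_trans]

theorem hol_mk_symm {x y : X} (γ : Path x y) : Φ.hol (.mk γ.symm) = (Φ.hol (.mk γ))⁻¹ := by
  rw [eq_inv_iff_mul_eq_one, Path.Homotopic.Quotient.mk_symm, ← Φ.hol_trans,
    Path.Homotopic.Quotient.trans_symm, hol_refl]

theorem hol_mk_cast {x y x' y' : X} (γ : Path x y) (hx : x' = x) (hy : y' = y) :
    Φ.hol (.mk (γ.cast hx hy)) = Φ.hol (.mk γ) := by
  subst hx hy; rfl

theorem hol_mk_subpath {x y : X} (γ : Path x y) (r s t : unitInterval) :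
    Φ.hol (.mk (γ.subpath r t)) = Φ.hol (.mk (γ.subpath s t)) * Φ.hol (.mk (γ.subpath r s)) := by
  rw [← hol_mk_trans, Path.Homotopic.Quotient.eq.mpr ⟨Path.Homotopy.subpathTransSubpath γ r s t⟩]

/-- A holonomy is locally trivial if every point `x` has a neighbourhood such that the loops at `x`
inside it have trivial holonomy. -/
def IsLocallyTrivial : Prop :=
  ∀ x : X, ∃ W : Set X, IsOpen W ∧ x ∈ W ∧
    ∀ β : Path x x, (∀ t, β t ∈ W) → Φ.hol (.mk β) = 1

/-- Near every point, a locally trivial holonomy is a coboundary: it is the change of a function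
`h` on the points. -/
theorem IsLocallyTrivial.exists_potential [LocallyPathConnectedSpace X] {Φ : Holonomy X G}
    (hΦ : Φ.IsLocallyTrivial) (x : X) :
    ∃ U : Set X, IsOpen U ∧ x ∈ U ∧ ∃ h : X → G, ∀ y ∈ U, ∀ y' ∈ U, ∀ δ : Path y y',
      (∀ t, δ t ∈ U) → h y' = Φ.hol (.mk δ) * h y := by
  obtain ⟨W, hW, hxW, hloop⟩ := hΦ x
  have hjoin : ∀ y ∈ pathComponentIn W x, ∃ (c : G) (β : Path x y),
      (∀ t, β t ∈ W) ∧ c = Φ.hol (.mk β) := fun y ⟨β, hβ⟩ => ⟨_, β, hβ, rfl⟩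
  choose! h hjoin using hjoin
  refine ⟨pathComponentIn W x, hW.pathComponentIn x, mem_pathComponentIn_self hxW,
    h, fun y hy y' hy' δ hδ => ?_⟩
  obtain ⟨β, hβ, hβy⟩ := hjoin y hy
  obtain ⟨β', hβ', hβy'⟩ := hjoin y' hy'
  have hl := hloop ((β.trans δ).trans β'.symm) fun t => by
    have ht : ((β.trans δ).trans β'.symm) t ∈ Set.range ((β.trans δ).trans β'.symm) := ⟨t, rfl⟩
    rw [Path.trans_range, Path.trans_range, Path.symm_range] at ht
    obtain (⟨s, hs⟩ | ⟨s, hs⟩) | ⟨s, hs⟩ := ht <;> rw [← hs]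
    · exact hβ s
    · exact pathComponentIn_subset (hδ s)
    · exact hβ' s
  rw [hol_mk_trans, hol_mk_trans, hol_mk_symm, inv_mul_eq_one] at hl
  rw [hβy, hβy', hl]

/-- The covering space defined by a holonomy `Φ`, with underlying set `X × G`. The path `δ` from `x`
to `y` transports the point `(x, g)` to `(y, Φ(δ) g)`. -/
@[ext]
structure Cover (Φ : Holonomy X G) where
  /-- the point of `X` below -/
  base : X
  /-- the position in the fibre -/
  sheet : G

/-- A set is open if with each of its points it contains all transports along sufficiently small
paths. -/
instance : TopologicalSpace Φ.Cover where
  IsOpen O := ∀ e ∈ O, ∃ W : Set X, IsOpen W ∧ e.base ∈ W ∧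
    ∀ (y : X) (δ : Path e.base y), (∀ t, δ t ∈ W) → (⟨y, Φ.hol (.mk δ) * e.sheet⟩ : Φ.Cover) ∈ O
  isOpen_univ := fun _ _ => ⟨Set.univ, isOpen_univ, trivial, fun _ _ _ => trivial⟩
  isOpen_inter := fun O O' hO hO' e he => by
    obtain ⟨W, hW, heW, h⟩ := hO e he.1
    obtain ⟨W', hW', heW', h'⟩ := hO' e he.2
    exact ⟨W ∩ W', hW.inter hW', ⟨heW, heW'⟩, fun y δ hδ =>
      ⟨h y δ fun t => (hδ t).1, h' y δ fun t => (hδ t).2⟩⟩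
  isOpen_sUnion := fun 𝒪 h𝒪 e ⟨O, hO, he⟩ => by
    obtain ⟨W, hW, heW, h⟩ := h𝒪 O hO e he
    exact ⟨W, hW, heW, fun y δ hδ => ⟨O, hO, h y δ hδ⟩⟩

theorem isOpen_cover_iff {O : Set Φ.Cover} :
    IsOpen O ↔ ∀ e ∈ O, ∃ W : Set X, IsOpen W ∧ e.base ∈ W ∧ ∀ (y : X) (δ : Path e.base y),
      (∀ t, δ t ∈ W) → (⟨y, Φ.hol (.mk δ) * e.sheet⟩ : Φ.Cover) ∈ O :=
  Iff.rfl

theorem continuous_base : Continuous (Cover.base : Φ.Cover → X) := by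
  refine continuous_def.mpr fun W hW => Φ.isOpen_cover_iff.mpr fun e he => ?_
  exact ⟨W, hW, he, fun y δ hδ => by simpa using hδ 1⟩

/-- The projection from the covering space to `X`. -/
def proj : C(Φ.Cover, X) := ⟨Cover.base, Φ.continuous_base⟩

/-- The lift of a path: the transport along its initial segments. -/
noncomputable def liftPath {x y : X} (γ : Path x y) (g : G) :
    Path (⟨x, g⟩ : Φ.Cover) ⟨y, Φ.hol (.mk γ) * g⟩ where
  toFun t := ⟨γ t, Φ.hol (.mk (γ.subpath 0 t)) * g⟩
  continuous_toFun := by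
    refine continuous_def.mpr fun O hO => isOpen_iff_mem_nhds.mpr fun t ht => ?_
    obtain ⟨W, hW, htW, h⟩ := Φ.isOpen_cover_iff.mp hO _ ht
    have hγW : γ ⁻¹' W ∈ 𝓝 t := (hW.preimage γ.continuous).mem_nhds htW
    have hs : ∀ᶠ s in 𝓝 t, Set.uIcc t s ⊆ γ ⁻¹' W :=
      (Filter.Tendsto.uIcc (tendsto_const_nhds (x := t)) Filter.tendsto_id).eventually
        (Filter.eventually_smallSets_subset.mpr hγW)
    filter_upwards [hs] with s hs
    have hmem := h (γ s) (γ.subpath t s) fun r => by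
      have hr : γ.subpath t s r ∈ Set.range (γ.subpath t s) := ⟨r, rfl⟩
      rw [Path.range_subpath] at hr
      obtain ⟨r', hr', hrr'⟩ := hr
      exact hrr' ▸ hs hr'
    rw [← mul_assoc, ← Φ.hol_mk_subpath] at hmem
    exact hmem
  source' := by
    ext
    · exact γ.source
    · change Φ.hol (.mk (γ.subpath 0 0)) * g = g
      rw [Path.subpath_self, Path.Homotopic.Quotient.mk_refl, Φ.hol_refl, one_mul]
  target' := by
    ext
    · exact γ.target
    · change Φ.hol (.mk (γ.subpath 0 1)) * g = _
      rw [Path.subpath_zero_one, Φ.hol_mk_cast]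

/-- A potential `h` near `x` trivialises the projection: `(y, g) ↦ (y, h(y)⁻¹ g)` is unchanged in
its second coordinate by transport along small paths. -/
theorem IsLocallyTrivial.isCoveringMap_proj [LocallyPathConnectedSpace X] {Φ : Holonomy X G}
    (hΦ : Φ.IsLocallyTrivial) : IsCoveringMap Φ.proj := by
  intro x
  let _ : TopologicalSpace G := ⊥
  have : DiscreteTopology G := ⟨rfl⟩
  obtain ⟨U, hU, hxU, h, hh⟩ := hΦ.exists_potential x
  refine IsEvenlyCovered.to_isEvenlyCovered_preimage (I := G)
    ⟨inferInstance, U, hxU, hU, hU.preimage Φ.proj.continuous,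
      { toFun := fun e => (⟨e.1.base, e.2⟩, (h e.1.base)⁻¹ * e.1.sheet)
        invFun := fun a => ⟨⟨a.1, h a.1 * a.2⟩, a.1.2⟩
        left_inv := fun e => Subtype.ext (Cover.ext rfl (mul_inv_cancel_left _ _))
        right_inv := fun a => Prod.ext rfl (inv_mul_cancel_left _ _)
        continuous_toFun := ?_
        continuous_invFun := ?_ }, fun _ => rfl⟩
  · refine Continuous.prodMk ((Φ.continuous_base.comp continuous_subtype_val).subtype_mk _) ?_
    -- the second coordinate is locally constant, since the potential absorbs small transports
    refine (IsLocallyConstant.iff_continuous _).mp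
      ((IsLocallyConstant.iff_exists_open _).mpr fun e => ?_)
    refine ⟨Subtype.val ⁻¹' {e' : Φ.Cover | e'.base ∈ U ∧
      (h e'.base)⁻¹ * e'.sheet = (h e.1.base)⁻¹ * e.1.sheet}, ?_, ⟨e.2, rfl⟩, fun e' he' => he'.2⟩
    refine IsOpen.preimage continuous_subtype_val (Φ.isOpen_cover_iff.mpr fun e' he' => ?_)
    refine ⟨U, hU, he'.1, fun y δ hδ => ?_⟩
    have hy : y ∈ U := by simpa using hδ 1
    refine ⟨hy, ?_⟩
    change (h y)⁻¹ * (Φ.hol (.mk δ) * e'.sheet) = _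
    rw [hh _ he'.1 y hy δ hδ, ← he'.2]
    group
  · refine Continuous.subtype_mk ?_ _
    refine continuous_def.mpr fun O hO => isOpen_iff_mem_nhds.mpr fun ⟨⟨y, hy⟩, g⟩ hyg => ?_
    obtain ⟨W, hW, hyW, hWO⟩ := Φ.isOpen_cover_iff.mp hO _ hyg
    have hV : pathComponentIn (W ∩ U) y ∈ 𝓝 y :=
      pathComponentIn_mem_nhds ((hW.inter hU).mem_nhds ⟨hyW, hy⟩)
    have hV' : (Subtype.val ⁻¹' pathComponentIn (W ∩ U) y : Set U) ×ˢ ({g} : Set G) ∈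
        𝓝 ((⟨y, hy⟩ : U), g) :=
      prod_mem_nhds (continuous_subtype_val.continuousAt hV) (by simp)
    refine Filter.mem_of_superset hV' ?_
    rintro ⟨⟨y', hy'⟩, g'⟩ ⟨⟨δ, hδ⟩, rfl⟩
    have hmem := hWO y' δ fun t => (hδ t).1
    rw [← mul_assoc, ← hh y hy y' hy' δ fun t => (hδ t).2] at hmem
    exact hmem

/-- The continuous map of covering spaces induced by a homomorphism compatible with the two
holonomies. -/
def coverMap {G' : Type*} [Group G'] (Φ : Holonomy X G) (Φ' : Holonomy X G') (φ : G →* G')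
    (hφ : ∀ {x y : X} (γ : Path x y), φ (Φ.hol (.mk γ)) = Φ'.hol (.mk γ)) :
    C(Φ.Cover, Φ'.Cover) where
  toFun e := ⟨e.base, φ e.sheet⟩
  continuous_toFun := by
    refine continuous_def.mpr fun O hO => Φ.isOpen_cover_iff.mpr fun e he => ?_
    obtain ⟨W, hW, heW, h⟩ := Φ'.isOpen_cover_iff.mp hO _ he
    refine ⟨W, hW, heW, fun y δ hδ => ?_⟩
    have := h y δ hδ
    rw [← hφ, ← map_mul] at this
    exact this

/-! ### The holonomy modulo a normal subgroup -/

section Normal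

open PathConnectedSpace (somePath)

variable [PathConnectedSpace X] (x₀ : X) (N : Subgroup (FundamentalGroup X x₀)) [N.Normal]

/-- The holonomy with values in `π₁(X, x₀) / N`: a path is completed to a loop at `x₀` by fixed
paths from `x₀` to its endpoints. -/
noncomputable def ofNormal : Holonomy X (FundamentalGroup X x₀ ⧸ N) where
  hol {x y} γ := QuotientGroup.mk (FundamentalGroup.fromPath
    ((Path.Homotopic.Quotient.mk (somePath x₀ x)).trans
      (γ.trans (Path.Homotopic.Quotient.mk (somePath x₀ y)).symm)))
  hol_trans {x y z} γ δ := by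
    rw [← QuotientGroup.mk_mul]
    congr 1
    rw [FundamentalGroup.mul_def]
    simp only [Path.Homotopic.Quotient.trans_assoc]
    rw [← Path.Homotopic.Quotient.trans_assoc (Path.Homotopic.Quotient.symm _),
      Path.Homotopic.Quotient.symm_trans, Path.Homotopic.Quotient.refl_trans]

theorem ofNormal_hol_eq_one_iff {x : X} (γ : Path.Homotopic.Quotient x x) :
    (ofNormal x₀ N).hol γ = 1 ↔ FundamentalGroup.fromPath
      ((Path.Homotopic.Quotient.mk (somePath x₀ x)).trans
        (γ.trans (Path.Homotopic.Quotient.mk (somePath x₀ x)).symm)) ∈ N :=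
  QuotientGroup.eq_one_iff _

/-- On loops at `x₀` the holonomy is a conjugate of the quotient map, so its kernel is `N`. -/
theorem ofNormal_hol_eq_one_iff_mem (g : FundamentalGroup X x₀) :
    (ofNormal x₀ N).hol (FundamentalGroup.toPath g) = 1 ↔ g ∈ N := by
  rw [ofNormal_hol_eq_one_iff]
  set s : FundamentalGroup X x₀ :=
    FundamentalGroup.fromPath (Path.Homotopic.Quotient.mk (somePath x₀ x₀))
  have h : FundamentalGroup.fromPath
      ((Path.Homotopic.Quotient.mk (somePath x₀ x₀)).trans
        ((FundamentalGroup.toPath g).trans (Path.Homotopic.Quotient.mk (somePath x₀ x₀)).symm)) =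
      s⁻¹ * g * s := by
    rw [FundamentalGroup.mul_def, FundamentalGroup.mul_def, FundamentalGroup.inv_def]
  rw [h]
  exact (Subgroup.Normal.mem_comm_iff ‹_›).trans (by rw [mul_inv_cancel_left])

/-- If `N` is open, then small loops have trivial holonomy: the loops `α β α⁻¹`, for `β` a small
loop at the end of `α`, are close to the null-homotopic loop `α α⁻¹`, so their classes lie
in `N`. -/
theorem ofNormal_isLocallyTrivial
    (hN : IsOpen[piOneTopology x₀] (N : Set (FundamentalGroup X x₀))) :
    (ofNormal x₀ N).IsLocallyTrivial := by
  intro x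
  have hN' : IsOpen {γ : Path x₀ x₀ |
      FundamentalGroup.fromPath (Path.Homotopic.Quotient.mk γ) ∈ N} := isOpen_coinduced.mp hN
  have hc : Continuous fun β : Path x x =>
      (somePath x₀ x).trans (β.trans (somePath x₀ x).symm) :=
    continuous_const.path_trans (continuous_id.path_trans continuous_const)
  have hmem : ∀ β : Path x x, (somePath x₀ x).trans (β.trans (somePath x₀ x).symm) ∈
      {γ : Path x₀ x₀ | FundamentalGroup.fromPath (Path.Homotopic.Quotient.mk γ) ∈ N} ↔
      (ofNormal x₀ N).hol (.mk β) = 1 := fun β => by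
    rw [ofNormal_hol_eq_one_iff]
    simp only [Set.mem_ofPred_eq, Path.Homotopic.Quotient.mk_trans, Path.Homotopic.Quotient.mk_symm]
  obtain ⟨W, hW, hxW, h⟩ := exists_isOpen_forall_loop_mem
    ((hN'.preimage hc).mem_nhds (x := Path.refl x)
      ((hmem _).mpr ((ofNormal x₀ N).hol_refl x)))
  exact ⟨W, hW, hxW, fun β hβ => (hmem β).mp (h β hβ)⟩

instance : PathConnectedSpace (ofNormal x₀ N).Cover where
  nonempty := ⟨⟨x₀, 1⟩⟩
  joined := by
    -- every position in the fibre over `y` is reached from `(x, g)` by a suitable path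
    rintro ⟨x, g⟩ ⟨y, g'⟩
    obtain ⟨k, hk⟩ := QuotientGroup.mk_surjective (g' * g⁻¹)
    have hhol : (ofNormal x₀ N).hol ((Path.Homotopic.Quotient.mk (somePath x₀ x)).symm.trans
        ((FundamentalGroup.toPath k).trans (.mk (somePath x₀ y)))) = g' * g⁻¹ := by
      rw [← hk]
      change QuotientGroup.mk _ = QuotientGroup.mk _
      congr 1
      simp only [Path.Homotopic.Quotient.trans_assoc, Path.Homotopic.Quotient.trans_symm,
        Path.Homotopic.Quotient.trans_refl]
      rw [← Path.Homotopic.Quotient.trans_assoc, Path.Homotopic.Quotient.trans_symm,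
        Path.Homotopic.Quotient.refl_trans]
    obtain ⟨γ, hγ⟩ := Path.Homotopic.Quotient.mk_surjective
      ((Path.Homotopic.Quotient.mk (somePath x₀ x)).symm.trans
        ((FundamentalGroup.toPath k).trans (.mk (somePath x₀ y))))
    rw [← hγ] at hhol
    exact ⟨((ofNormal x₀ N).liftPath γ g).cast rfl (by rw [hhol, inv_mul_cancel_right])⟩

end Normal

end Holonomy

/-! ### The fundamental group of a covering space -/

theorem mem_imagePiOne_iff {E X : Type*} [TopologicalSpace E] [TopologicalSpace X]
    {p : C(E, X)} {e₀ : E} {x₀ : X} {h : p e₀ = x₀} {g : FundamentalGroup X x₀} :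
    g ∈ imagePiOne p h ↔ ∃ δ : Path e₀ e₀, FundamentalGroup.fromPath
      (.mk ((δ.map p.continuous).cast h.symm h.symm)) = g := by
  constructor
  · rintro ⟨d, rfl⟩
    obtain ⟨δ, rfl⟩ := Path.Homotopic.Quotient.mk_surjective d
    exact ⟨δ, (FundamentalGroup.mapOfEq_apply p h (.mk δ)).symm⟩
  · rintro ⟨δ, rfl⟩
    exact ⟨FundamentalGroup.fromPath (.mk δ), FundamentalGroup.mapOfEq_apply p h (.mk δ)⟩

theorem IsRegularCoveringProjection.normal_imagePiOne {E X : Type*} [TopologicalSpace E]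
    [TopologicalSpace X] {p : C(E, X)} (hp : IsRegularCoveringProjection p) {e₀ : E} {x₀ : X}
    (h : p e₀ = x₀) : (imagePiOne p h).Normal := by
  subst h; exact hp.normal e₀

namespace IsCoveringMap

variable {E X : Type*} [TopologicalSpace E] [TopologicalSpace X] {p : C(E, X)}

theorem liftPath_eq_of_lifts (cov : IsCoveringMap p) {γ : C(unitInterval, X)} {e : E}
    (hγ : γ 0 = p e) (Γ : C(unitInterval, E)) (h₀ : Γ 0 = e) (h : ∀ t, p (Γ t) = γ t) :
    cov.liftPath γ e hγ = Γ :=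
  ((cov.eq_liftPath_iff' hγ).mpr ⟨funext h, h₀⟩).symm

theorem apply_liftPath (cov : IsCoveringMap p) {γ : C(unitInterval, X)} {e : E}
    (hγ : γ 0 = p e) (t : unitInterval) : p (cov.liftPath γ e hγ t) = γ t :=
  congrFun (cov.liftPath_lifts γ e hγ) t

/-- A loop represents an element of `p_#(π₁(E, e₀))` if and only if its lift closes up. -/
theorem mk_mem_imagePiOne_iff (cov : IsCoveringMap p) {e₀ : E} {x₀ : X} (h : p e₀ = x₀)
    (γ : Path x₀ x₀) :
    FundamentalGroup.fromPath (.mk γ) ∈ imagePiOne p h ↔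
      cov.liftPath γ e₀ (γ.source.trans h.symm) 1 = e₀ := by
  rw [mem_imagePiOne_iff]
  constructor
  · rintro ⟨δ, hδ⟩
    have hhom := Path.Homotopic.Quotient.eq.mp hδ
    have hend := cov.liftPath_apply_one_eq_of_homotopicRel hhom e₀
      ((Path.source _).trans h.symm) (γ.source.trans h.symm)
    rw [cov.liftPath_eq_of_lifts _ (δ : C(unitInterval, E)) δ.source fun t => rfl] at hend
    exact hend.symm.trans δ.target
  · intro h₁
    refine ⟨⟨cov.liftPath γ e₀ (γ.source.trans h.symm), cov.liftPath_zero _ _ _, h₁⟩, ?_⟩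
    congr 2
    ext t
    exact cov.apply_liftPath (γ.source.trans h.symm) t

/-- Lifts depend continuously on the path. -/
theorem continuous_liftPath (cov : IsCoveringMap p) {A : Type*} [TopologicalSpace A]
    (γ : A → C(unitInterval, X)) (hγ : Continuous γ) (e : E) (h : ∀ a, γ a 0 = p e) :
    Continuous fun at' : A × unitInterval => cov.liftPath (γ at'.1) e (h at'.1) at'.2 := by
  let H : C(unitInterval × A, X) := ⟨fun ta => γ ta.2 ta.1, by fun_prop⟩
  exact (cov.liftHomotopy H (ContinuousMap.const A e) h).continuous.comp continuous_swap

theorem isOpen_imagePiOne (cov : IsCoveringMap p) {e₀ : E} {x₀ : X} (h : p e₀ = x₀) :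
    IsOpen[piOneTopology x₀] (imagePiOne p h : Set (FundamentalGroup X x₀)) := by
  refine isOpen_coinduced.mpr ?_
  have hd : DiscreteTopology (p ⁻¹' {x₀}) := (cov x₀).1
  let φ : Path x₀ x₀ → p ⁻¹' {x₀} := fun γ =>
    ⟨cov.liftPath γ e₀ (γ.source.trans h.symm) 1, (cov.apply_liftPath _ 1).trans γ.target⟩
  have hφ : Continuous φ := Continuous.subtype_mk
    ((cov.continuous_liftPath (fun γ : Path x₀ x₀ => (γ : C(unitInterval, X)))
      continuous_induced_dom e₀ fun γ => γ.source.trans h.symm).comp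
        (continuous_id.prodMk continuous_const)) _
  convert (isOpen_discrete ({⟨e₀, h⟩} : Set (p ⁻¹' {x₀}))).preimage hφ using 1
  ext γ
  exact (cov.mk_mem_imagePiOne_iff h γ).trans
    (Subtype.ext_iff (a1 := φ γ) (a2 := ⟨e₀, h⟩)).symm

end IsCoveringMap

namespace Holonomy

variable {X : Type*} [TopologicalSpace X] [LocallyPathConnectedSpace X]

theorem IsLocallyTrivial.mem_imagePiOne_proj_iff {G : Type*} [Group G] {Φ : Holonomy X G}
    (hΦ : Φ.IsLocallyTrivial) {e : Φ.Cover} {x : X} (h : Φ.proj e = x)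
    (g : FundamentalGroup X x) :
    g ∈ imagePiOne Φ.proj h ↔ Φ.hol (FundamentalGroup.toPath g) = 1 := by
  obtain ⟨y, w⟩ := e
  subst h
  obtain ⟨γ, rfl⟩ := Path.Homotopic.Quotient.mk_surjective g
  have hlift := hΦ.isCoveringMap_proj.liftPath_eq_of_lifts γ.source
    (Φ.liftPath γ w : C(unitInterval, Φ.Cover)) (Φ.liftPath γ w).source fun t => rfl
  have hend := (congrArg (fun Γ : C(unitInterval, Φ.Cover) => Γ 1) hlift).trans
    (Φ.liftPath γ w).target
  refine (hΦ.isCoveringMap_proj.mk_mem_imagePiOne_iff rfl γ).trans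
    ((Eq.congr_left hend).trans ?_)
  exact Cover.ext_iff.trans ((and_iff_right rfl).trans mul_eq_right)

/-- The fundamental group of the covering space at any point is the kernel of the holonomy on
loops, so it is normal. -/
theorem isRegularCoveringProjection_proj_ofNormal [PathConnectedSpace X] (x₀ : X)
    (N : Subgroup (FundamentalGroup X x₀)) [N.Normal]
    (hN : IsOpen[piOneTopology x₀] (N : Set (FundamentalGroup X x₀))) :
    IsRegularCoveringProjection (ofNormal x₀ N).proj where
  pathConnected := inferInstance
  isCoveringMap := (ofNormal_isLocallyTrivial x₀ N hN).isCoveringMap_proj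
  normal e := by
    have hmem := (ofNormal_isLocallyTrivial x₀ N hN).mem_imagePiOne_proj_iff (rfl : _ =
      (ofNormal x₀ N).proj e)
    refine ⟨fun g hg k => ?_⟩
    rw [hmem] at hg ⊢
    rw [FundamentalGroup.mul_def, FundamentalGroup.mul_def, hol_trans, hol_trans, hg, mul_one,
      ← hol_trans, FundamentalGroup.inv_def, Path.Homotopic.Quotient.symm_trans, hol_refl]

theorem imagePiOne_proj_ofNormal [PathConnectedSpace X] (x₀ : X)
    (N : Subgroup (FundamentalGroup X x₀)) [N.Normal]
    (hN : IsOpen[piOneTopology x₀] (N : Set (FundamentalGroup X x₀)))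
    {e : (ofNormal x₀ N).Cover} (h : (ofNormal x₀ N).proj e = x₀) :
    imagePiOne (ofNormal x₀ N).proj h = N := by
  ext g
  rw [(ofNormal_isLocallyTrivial x₀ N hN).mem_imagePiOne_proj_iff h g,
    ofNormal_hol_eq_one_iff_mem]

end Holonomy

/-! ### Inverse limits of coverings -/

namespace InverseSystemOver

variable {X : Type u} [TopologicalSpace X] {S : InverseSystemOver X}

theorem continuous_component_apply {e₀ : S.Limit} (j : S.J) :
    Continuous fun x : S.Component e₀ => x.1.1 j :=
  (continuous_apply j).comp (continuous_subtype_val.comp continuous_subtype_val)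

theorem componentMap_apply {e₀ : S.Limit} (x : S.Component e₀) (j : S.J) :
    S.componentMap e₀ x = S.p j (x.1.1 j) :=
  S.limitMap_apply x.1 j

/-- The lift of a path to a path component of a limit of coverings: the family of its lifts to the
single coverings, which are compatible by uniqueness of lifts. -/
noncomputable def liftComponent (hS : ∀ j, IsCoveringMap (S.p j)) {e₀ : S.Limit}
    (e : S.Component e₀) (γ : C(unitInterval, X)) (hγ : γ 0 = S.componentMap e₀ e) :
    C(unitInterval, S.Component e₀) :=
  have h j : γ 0 = S.p j (e.1.1 j) := hγ.trans (componentMap_apply e j)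
  have hcompat (t : unitInterval) (i j : S.J) (hij : i ≤ j) :
      S.f hij ((hS j).liftPath γ _ (h j) t) = (hS i).liftPath γ _ (h i) t := by
    rw [(hS i).liftPath_eq_of_lifts (h i) ((S.f hij).comp ((hS j).liftPath γ _ (h j)))]
    · rfl
    · exact (congrArg _ ((hS j).liftPath_zero _ _ _)).trans (e.1.2 i j hij)
    · exact fun t => (S.p_comp hij _).trans ((hS j).apply_liftPath _ t)
  let Γ : C(unitInterval, S.Limit) :=
    ⟨fun t => ⟨fun j => (hS j).liftPath γ _ (h j) t, hcompat t⟩, by fun_prop⟩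
  have h₀ : Γ 0 = e.1 := Subtype.ext (funext fun j => (hS j).liftPath_zero _ _ _)
  { toFun t := ⟨Γ t, Joined.trans e.2
      ⟨((⟨Γ, rfl, rfl⟩ : Path (Γ 0) (Γ 1)).subpath 0 t).cast h₀.symm rfl⟩⟩
    continuous_toFun := Γ.continuous.subtype_mk _ }

theorem liftComponent_zero (hS : ∀ j, IsCoveringMap (S.p j)) {e₀ : S.Limit}
    (e : S.Component e₀) (γ : C(unitInterval, X)) (hγ : γ 0 = S.componentMap e₀ e) :
    liftComponent hS e γ hγ 0 = e :=
  Subtype.ext (Subtype.ext (funext fun j => (hS j).liftPath_zero _ _ _))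

theorem componentMap_liftComponent (hS : ∀ j, IsCoveringMap (S.p j)) {e₀ : S.Limit}
    (e : S.Component e₀) (γ : C(unitInterval, X)) (hγ : γ 0 = S.componentMap e₀ e)
    (t : unitInterval) : S.componentMap e₀ (liftComponent hS e γ hγ t) = γ t :=
  (hS _).apply_liftPath (hγ.trans (componentMap_apply e _)) t

theorem hasContinuousPathCovering_componentMap (hS : ∀ j, IsCoveringMap (S.p j)) (e₀ : S.Limit) :
    HasContinuousPathCovering (S.componentMap e₀) := by
  intro e
  let φ : BasedPaths (S.Component e₀) e ≃ₜ BasedPaths X (S.componentMap e₀ e) :=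
    { toFun := BasedPaths.map (S.componentMap e₀) e
      invFun := fun γ => ⟨liftComponent hS e γ.1 γ.2, liftComponent_zero hS e γ.1 γ.2⟩
      left_inv := fun Γ => by
        refine Subtype.ext (ContinuousMap.ext fun t => Subtype.ext (Subtype.ext (funext fun j => ?_)))
        let Γj : C(unitInterval, S.E j) := 
          ⟨fun t => (Γ.1 t).1.1 j, (continuous_component_apply j).comp Γ.1.continuous⟩
        change (hS j).liftPath _ _ _ t = Γj t
        rw [(hS j).liftPath_eq_of_lifts _ Γj]
        · exact congrArg (fun x : S.Component e₀ => x.1.1 j) Γ.2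
        · exact fun s => (componentMap_apply (Γ.1 s) j).symm
      right_inv := fun γ => Subtype.ext (ContinuousMap.ext fun t =>
        componentMap_liftComponent hS e γ.1 γ.2 t)
      continuous_toFun := Continuous.subtype_mk
        ((ContinuousMap.continuous_postcomp _).comp continuous_subtype_val) _
      continuous_invFun := by
        refine Continuous.subtype_mk (ContinuousMap.continuous_of_continuous_uncurry _ ?_) _
        exact Continuous.subtype_mk (Continuous.subtype_mk (continuous_pi fun j =>
          (hS j).continuous_liftPath (fun γ : BasedPaths X (S.componentMap e₀ e) => γ.1)
            continuous_subtype_val (e.1.1 j)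
            fun γ => γ.2.trans (componentMap_apply e j)) _) _ }
  exact φ.isHomeomorph

/-- A loop lifts to a loop in the limit if and only if it lifts to a loop in each covering. -/
theorem imagePiOne_componentMap (hS : ∀ j, IsCoveringMap (S.p j)) {e₀ : S.Limit} {x₀ : X}
    (h : S.componentMap e₀ (S.basePoint e₀) = x₀) :
    imagePiOne (S.componentMap e₀) h =
      ⨅ j, imagePiOne (S.p j) ((componentMap_apply (S.basePoint e₀) j).symm.trans h) := by
  ext g
  obtain ⟨γ, rfl⟩ := Path.Homotopic.Quotient.mk_surjective g
  rw [Subgroup.mem_iInf]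
  constructor
  · intro hg j
    obtain ⟨δ, hδ⟩ := mem_imagePiOne_iff.mp hg
    refine mem_imagePiOne_iff.mpr
      ⟨δ.map (f := fun x : S.Component e₀ => x.1.1 j)
        (continuous_component_apply j), ?_⟩
    rw [← hδ]
    congr 2
    ext t
    exact (componentMap_apply (δ t) j).symm
  · intro hg
    have hγ : (γ : C(unitInterval, X)) 0 = S.componentMap e₀ (S.basePoint e₀) :=
      γ.source.trans h.symm
    refine mem_imagePiOne_iff.mpr ⟨⟨liftComponent hS (S.basePoint e₀) γ hγ,
      liftComponent_zero hS _ _ hγ, ?_⟩, ?_⟩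
    · exact Subtype.ext (Subtype.ext (funext fun j =>
        ((hS j).mk_mem_imagePiOne_iff _ γ).mp (hg j)))
    · congr 2
      ext t
      exact componentMap_liftComponent hS _ _ hγ t

/-- The open normal subgroups of `π₁(X, x₀)` that contain `H`. -/
abbrev OpenNormalAbove {x₀ : X} (H : Subgroup (FundamentalGroup X x₀)) : Type u :=
  {N : Subgroup (FundamentalGroup X x₀) // IsOpenNormal N ∧ H ≤ N}

instance {x₀ : X} {H : Subgroup (FundamentalGroup X x₀)} (N : OpenNormalAbove H) : N.1.Normal :=
  N.2.1.1

open Holonomy OrderDual in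
/-- The inverse system of the coverings given by the open normal subgroups that contain `H`, ordered
by reverse inclusion. -/
noncomputable def ofOpenNormal [PathConnectedSpace X] {x₀ : X}
    (H : Subgroup (FundamentalGroup X x₀)) : InverseSystemOver X where
  J := (OpenNormalAbove H)ᵒᵈ
  directed := ⟨fun M N => by
    refine ⟨toDual ⟨(ofDual M).1 ⊓ (ofDual N).1, ⟨inferInstance, ?_⟩,
      le_inf (ofDual M).2.2 (ofDual N).2.2⟩, ?_, ?_⟩
    · exact @IsOpen.inter _ (piOneTopology x₀) _ _ (ofDual M).2.1.2 (ofDual N).2.1.2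
    · exact inf_le_left (a := (ofDual M).1)
    · exact inf_le_right (a := (ofDual M).1)⟩
  nonempty := ⟨toDual ⟨⊤, ⟨inferInstance, @isOpen_univ _ (piOneTopology x₀)⟩, le_top⟩⟩
  E N := (ofNormal x₀ (ofDual N).1).Cover
  p N := (ofNormal x₀ (ofDual N).1).proj
  f {M N} h := coverMap (ofNormal x₀ (ofDual N).1) (ofNormal x₀ (ofDual M).1)
    (QuotientGroup.map _ _ (MonoidHom.id _) h) fun _ => rfl
  f_refl _ x := Cover.ext rfl (QuotientGroup.map_id_apply _ _ _)
  f_comp _ _ x := Cover.ext rfl (by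
    obtain ⟨g, hg⟩ := QuotientGroup.mk_surjective x.sheet
    simp only [coverMap, ContinuousMap.coe_mk, ← hg]
    rfl)
  p_comp _ _ := rfl

end InverseSystemOver

/-! ### Intersections of open normal subgroups -/

theorem theorem7p3 {X : Type u} [TopologicalSpace X] [PathConnectedSpace X]
    [LocallyPathConnectedSpace X] (x₀ : X) (H : Subgroup (FundamentalGroup X x₀)) :
    IsInterOpenNormal H ↔
      ∃ S : InverseSystemOver X,
        (∀ j, IsRegularCoveringProjection (S.p j)) ∧
          ∃ (e₀ : S.Limit) (h : S.componentMap e₀ (S.basePoint e₀) = x₀),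
            Corresponds (S.componentMap e₀) h H := by
  constructor
  · rintro ⟨𝒩, h𝒩, hH⟩
    -- all open normal subgroups above `H` are used, since `𝒩` need not be directed
    let S := InverseSystemOver.ofOpenNormal H
    have hreg : ∀ j, IsRegularCoveringProjection (S.p j) :=
      fun N : (InverseSystemOver.OpenNormalAbove H)ᵒᵈ =>
      Holonomy.isRegularCoveringProjection_proj_ofNormal x₀ _ (OrderDual.ofDual N).2.1.2
    let e₀ : S.Limit := ⟨fun N : (InverseSystemOver.OpenNormalAbove H)ᵒᵈ =>
      (⟨x₀, 1⟩ : (Holonomy.ofNormal x₀ (OrderDual.ofDual N).1).Cover),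
      fun M N h => Holonomy.Cover.ext rfl (map_one _)⟩
    have hx : S.componentMap e₀ (S.basePoint e₀) = x₀ := rfl
    refine ⟨S, hreg, e₀, hx, S.hasContinuousPathCovering_componentMap
      (fun j => (hreg j).isCoveringMap) e₀, ?_⟩
    rw [S.imagePiOne_componentMap fun j => (hreg j).isCoveringMap]
    have himage : ∀ N : S.J, imagePiOne (S.p N) (rfl : S.p N (e₀.1 N) = x₀) =
        (OrderDual.ofDual N).1 := fun N : (InverseSystemOver.OpenNormalAbove H)ᵒᵈ =>
      Holonomy.imagePiOne_proj_ofNormal x₀ _ (OrderDual.ofDual N).2.1.2 rfl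
    refine le_antisymm ?_ (le_iInf fun N => (OrderDual.ofDual N).2.2.trans (himage N).ge)
    rw [hH]
    refine le_sInf fun N hN => ?_
    exact (iInf_le _ (OrderDual.toDual ⟨N, h𝒩 N hN, hH.trans_le (sInf_le hN)⟩ : S.J)).trans
      (himage _).le
  · rintro ⟨S, hreg, e₀, h, -, rfl⟩
    refine ⟨Set.range fun j => imagePiOne (S.p j)
      ((S.componentMap_apply (S.basePoint e₀) j).symm.trans h), ?_,
      S.imagePiOne_componentMap (fun j => (hreg j).isCoveringMap) h⟩
    rintro _ ⟨j, rfl⟩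
    exact ⟨(hreg j).normal_imagePiOne _, (hreg j).isCoveringMap.isOpen_imagePiOne _⟩
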